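/- Let $\mathbb F$ be a finite field and let $1\le k\le d<n$. Consider an $(n,k,d)$ distributed storage system with node capacity $\alpha$ that stores a linear MSR (optimal bandwidth MDS) code in systematic form with exact repair of the systematic nodes. That is: the $k$ systematic nodes $i\in[k]$ store vectors $w_i\in\mathbb F^\alpha$, the $n-k$ parity nodes store $w_{k+t}=\sum_{j=1}^k A_{t,j}w_j$ with fixed matrices $A_{t,j}\in\mathbb F^{\alpha\times\alpha}$, and any $k$ of the $n$ nodes determine all of $w_1,\dots,w_k$; moreover, for every systematic node $i$ and every set $D\subseteq[n]\setminus\{i\}$ of $d$ helper nodes there are fixed repair matrices $V_{m,i}(D)\in\mathbb F^{\beta\times\alpha}$, $m\in D$, with $\beta=\alpha/(d-k+1)$, such that $w_i$ is a function of the downloaded data $S^i_D=(V_{m,i}(D)\,w_m)_{m\in D}$. Let $\mathcal E_s\subseteq[n]$ and $\mathcal E_d\subseteq[k]\setminus\mathcal E_s$ with $|\mathcal E_s|=\ell_1$, $|\mathcal E_d|=\ell_2$ and $\ell_1+\ell_2<k$; an eavesdropper observes the data stored in the nodes of $\mathcal E_s$ and the data downloaded in the repair of the nodes of $\mathcal E_d$.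 Let $U$ (the file) be uniformly distributed on $\mathbb F^{M^s}$, and let $W_1,\dots,W_k$ be random vectors in $\mathbb F^\alpha$, with an arbitrary joint law with $U$, stored in the systematic nodes; for $i\in[n]$ let $W_i$ be the resulting random content of node $i$. Suppose that (reconstruction) $H(U\mid W_{\mathcal A})=0$ for every $\mathcal A\subseteq[n]$ with $|\mathcal A|=k$, and (perfect secrecy) $H(U\mid W_{\mathcal E_s},(S^j_{D_j})_{j\in\mathcal E_d})=H(U)$ for every choice of sets $D_j\subseteq[n]\setminus\{j\}$ of $d$ helper nodes, $j\in\mathcal E_d$. Then $$M^s\le (k-\ell_1-\ell_2)\left(1-\frac1{d-k+1}\right)^{\ell_2}\alpha ,$$ where $0^0=1$. -/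

import Mathlib

open scoped Matrix

noncomputable section

/-- Shannon entropy, in base `b`, of a random variable `X` with values in a finite set. -/
def entropy {Ω A : Type*} [Fintype A] (b : ℕ) (P : PMF Ω) (X : Ω → A) : ℝ :=
  (∑ a, Real.negMulLog (P.map X a).toReal) / Real.log b

/-- Conditional entropy `H(X | Y) = ∑ y, P(Y = y) H(X | Y = y)` in base `b`, where
`P(X = a | Y = y) = P(X = a, Y = y) / P(Y = y)`. Values `y` of probability `0` contribute `0`. -/
def condEntropy {Ω A B : Type*} [Fintype A] [Fintype B] (b : ℕ) (P : PMF Ω)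
    (X : Ω → A) (Y : Ω → B) : ℝ :=
  (∑ y, (P.map Y y).toReal *
    ∑ a, Real.negMulLog
      ((P.map (fun ω => (X ω, Y ω)) (a, y)).toReal / (P.map Y y).toReal)) / Real.log b

/-- The nodes of a storage system in systematic form: the `k` systematic nodes `Sum.inl i` and the
`n - k` parity nodes `Sum.inr t` (so there are `n` nodes when `k ≤ n`). -/
abbrev Node (n k : ℕ) : Type := Fin k ⊕ Fin (n - k)

/-- The matrices of a systematic linear storage code over `F` with node capacity `α`, together with
a linear scheme for repairing systematic nodes in which every helper sends `β` symbols. -/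
structure LinearDSS (F : Type*) (n k α β : ℕ) where
  /-- `A t j` is the coding matrix of parity node `t` for systematic node `j`. -/
  A : Fin (n - k) → Fin k → Matrix (Fin α) (Fin α) F
  /-- `V i D m` is the repair matrix used by helper `m` when the systematic node `i` is repaired
  by the helper set `D`. -/
  V : Fin k → Finset (Node n k) → Node n k → Matrix (Fin β) (Fin α) F

namespace LinearDSS

variable {F : Type*} [Field F] {n k α β : ℕ}

/-- The data vector `w_m` stored in node `m` when the systematic nodes store `x`. -/
def stored (C : LinearDSS F n k α β) (x : Fin k → Fin α → F) : Node n k → Fin α → F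
  | Sum.inl i => x i
  | Sum.inr t => ∑ j, C.A t j *ᵥ x j

/-- The symbols sent by helper `m` when systematic node `i` is repaired by the helper set `D`. -/
def sent (C : LinearDSS F n k α β) (x : Fin k → Fin α → F) (i : Fin k)
    (D : Finset (Node n k)) (m : Node n k) : Fin β → F :=
  C.V i D m *ᵥ C.stored x m

/-- `D` is an admissible helper set for systematic node `i`: any `d` nodes other than `i`. -/
def IsHelperSet (d : ℕ) (i : Fin k) (D : Finset (Node n k)) : Prop :=
  D.card = d ∧ (Sum.inl i : Node n k) ∉ D

/-- The code is an optimal bandwidth MDS (that is, MSR) code with repair degree `d` and exact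
repair of the systematic nodes. -/
structure IsMSR (C : LinearDSS F n k α β) (d : ℕ) : Prop where
  k_le_d : k ≤ d
  d_lt_n : d < n
  /-- Any `k` nodes determine all the stored data. -/
  mds : ∀ S : Finset (Node n k), S.card = k → ∀ x x' : Fin k → Fin α → F,
    (∀ m ∈ S, C.stored x m = C.stored x' m) → x = x'
  /-- The content of a systematic node is a function of the data downloaded from any `d` other
  nodes. -/
  exact_repair : ∀ (i : Fin k) (D : Finset (Node n k)), IsHelperSet d i D →
    ∀ x x' : Fin k → Fin α → F, (∀ m ∈ D, C.sent x i D m = C.sent x' i D m) → x i = x' i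
  /-- Each helper sends the minimum possible amount `β = α / (d - k + 1)`. -/
  optimal_bandwidth : β * (d - k + 1) = α

/-- The collection of the data stored in the nodes of `S`. -/
def storedOn (C : LinearDSS F n k α β) (S : Finset (Node n k)) (x : Fin k → Fin α → F) :
    S → Fin α → F :=
  fun m => C.stored x m

/-- All the data downloaded in the repairs of the systematic nodes `j ∈ E`, where node `j` is
repaired by the helper set `D j`. -/
def downloadedBy (C : LinearDSS F n k α β) (E : Finset (Fin k))
    (D : Fin k → Finset (Node n k)) (x : Fin k → Fin α → F) :
    (j : E) → D j → Fin β → F :=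
  fun j m => C.sent x j (D j) m

/-- The file `U` can be reconstructed from any `k` nodes: `H(U | W_S) = 0` whenever `|S| = k`.
Here `X` is the random content of the systematic nodes. -/
def IsReconstructible [Fintype F] {Ω : Type*} (C : LinearDSS F n k α β) (P : PMF Ω) {M : ℕ}
    (U : Ω → Fin M → F) (X : Ω → Fin k → Fin α → F) : Prop :=
  ∀ S : Finset (Node n k), S.card = k →
    condEntropy (Fintype.card F) P U (fun ω => C.storedOn S (X ω)) = 0

/-- Perfect secrecy against an eavesdropper who sees the data stored in the nodes of `Es` and the
data downloaded in the repairs of the systematic nodes of `Ed`: whichever `d` helpers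
serve each of these repairs, `H(U | W_Es, S^Ed) = H(U)`. -/
def IsPerfectlySecret [Fintype F] {Ω : Type*} (C : LinearDSS F n k α β) (d : ℕ) (P : PMF Ω) {M : ℕ}
    (U : Ω → Fin M → F) (X : Ω → Fin k → Fin α → F)
    (Es : Finset (Node n k)) (Ed : Finset (Fin k)) : Prop :=
  ∀ D : Fin k → Finset (Node n k), (∀ j ∈ Ed, IsHelperSet d j (D j)) →
    condEntropy (Fintype.card F) P U
      (fun ω => (C.storedOn Es (X ω), C.downloadedBy Ed D (X ω))) =
    entropy (Fintype.card F) P U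

end LinearDSS

end

noncomputable section

namespace LinearDSS

variable {F : Type*} [Field F] {n k d α β : ℕ}

/-! Fix a set `T` of `r = d - k + 1` parity nodes and repair each systematic node from the other
systematic nodes and `T`. Since `β * r = α`, the symbols from `T` are just enough to carry the lost
node (`desired_surjective`), so they have no room for interference: the matrix `A t j` must carry
the kernel of the repair matrix of helper `j` onto that of parity helper `t` (`map_ker_eq`).

Hence, for repairs of the nodes in `E`, the space of vectors hidden in what a node sends has the
same dimension `N E` for every systematic node outside `E` and every parity node in `T`. One more
repair, of `i`, takes rank `N E - N (insert i E)` on each parity's hidden space. The `r` parities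
together must recover the `N E` hidden dimensions of node `i`, so `N E ≤ r * (N E - N (insert i
E))`, a decay by the factor `1 - 1 / r` (`finrank_invisible_insert`).

Given the eavesdropper's view, the data are determined by `k - ℓ₁ - ℓ₂` further systematic nodes,
each free only within a coset of its hidden space. This bounds the number of compatible files, hence
`H(U | view)`, which secrecy makes equal to `M`. -/

lemma stored_sub (C : LinearDSS F n k α β) (x y : Fin k → Fin α → F) (m : Node n k) :
    C.stored (x - y) m = C.stored x m - C.stored y m := by
  cases m with
  | inl i => rfl
  | inr t => simp [stored, Matrix.mulVec_sub]

lemma stored_add (C : LinearDSS F n k α β) (x y : Fin k → Fin α → F) (m : Node n k) :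
    C.stored (x + y) m = C.stored x m + C.stored y m := by
  cases m with
  | inl i => rfl
  | inr t => simp [stored, Matrix.mulVec_add, Finset.sum_add_distrib]

@[simp]
lemma stored_zero (C : LinearDSS F n k α β) (m : Node n k) : C.stored 0 m = 0 := by
  simpa using C.stored_sub 0 0 m

lemma sent_sub (C : LinearDSS F n k α β) (x y : Fin k → Fin α → F) (i : Fin k)
    (D : Finset (Node n k)) (m : Node n k) :
    C.sent (x - y) i D m = C.sent x i D m - C.sent y i D m := by
  simp [sent, stored_sub, Matrix.mulVec_sub]

lemma stored_single_inr (C : LinearDSS F n k α β) (j : Fin k) (y : Fin α → F)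
    (t : Fin (n - k)) : C.stored (Pi.single j y) (Sum.inr t) = C.A t j *ᵥ y := by
  simp only [stored]
  rw [Finset.sum_eq_single j]
  · simp
  · intro b _ hb
    simp [Pi.single_eq_of_ne hb]
  · simp

/-- All systematic nodes other than `i`, together with the parity nodes in `T`. -/
def helperSet (T : Finset (Fin (n - k))) (i : Fin k) : Finset (Node n k) :=
  (Finset.univ.erase i).disjSum T

lemma isHelperSet_helperSet (hkd : k ≤ d) {T : Finset (Fin (n - k))}
    (hT : T.card = d - k + 1) (i : Fin k) : IsHelperSet d i (helperSet T i) := by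
  refine ⟨?_, by simp [helperSet]⟩
  have := i.pos
  simp only [helperSet, Finset.card_disjSum, Finset.card_erase_of_mem (Finset.mem_univ i),
    Finset.card_univ, Fintype.card_fin]
  omega

/-! ### Interference alignment for a single repair. -/

namespace IsMSR

variable {C : LinearDSS F n k α β}

lemma eq_zero_of_stored (hC : C.IsMSR d) {S : Finset (Node n k)} (hS : S.card = k)
    {x : Fin k → Fin α → F} (h : ∀ m ∈ S, C.stored x m = 0) : x = 0 :=
  hC.mds S hS x 0 fun m hm => by rw [h m hm, stored_zero]

lemma eq_zero_of_sent (hC : C.IsMSR d) {i : Fin k} {D : Finset (Node n k)}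
    (hD : IsHelperSet d i D) {x : Fin k → Fin α → F} (h : ∀ m ∈ D, C.sent x i D m = 0) :
    x i = 0 :=
  hC.exact_repair i D hD x 0 fun m hm => by rw [h m hm]; simp [sent]

lemma mulVec_injective (hC : C.IsMSR d) (t : Fin (n - k)) (j : Fin k) :
    Function.Injective (C.A t j).mulVecLin := by
  rw [injective_iff_map_eq_zero]
  intro y hy
  have := j.pos
  have h := hC.eq_zero_of_stored (S := (Finset.univ.erase j).disjSum {t})
    (x := Pi.single j y) (by
      simp only [Finset.card_disjSum, Finset.card_erase_of_mem (Finset.mem_univ j),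
        Finset.card_univ, Fintype.card_fin, Finset.card_singleton]
      omega) (by
      rintro (m | m) hm
      · have hm : m ≠ j := by simpa using hm
        simp [stored, Pi.single_eq_of_ne hm]
      · obtain rfl : m = t := by simpa using hm
        rw [stored_single_inr]
        exact hy)
  simpa using congrFun h j

/-- The coding matrices are invertible. -/
def codingEquiv (hC : C.IsMSR d) (t : Fin (n - k)) (j : Fin k) :
    (Fin α → F) ≃ₗ[F] (Fin α → F) :=
  LinearEquiv.ofInjectiveEndo _ (hC.mulVec_injective t j)

variable {T : Finset (Fin (n - k))}

/-- The contribution of the failed node `i` to the symbols sent by the parity helpers. -/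
def desired (C : LinearDSS F n k α β) (T : Finset (Fin (n - k))) (i : Fin k) :
    (Fin α → F) →ₗ[F] (T → Fin β → F) :=
  LinearMap.pi fun t =>
    (C.V i (helperSet T i) (Sum.inr t)).mulVecLin ∘ₗ (C.A t i).mulVecLin

/-- Test exact repair on data supported at node `i`: the systematic helpers then send zero, so only
the parities can reveal `y`. -/
lemma desired_injective (hC : C.IsMSR d) (hT : T.card = d - k + 1) (i : Fin k) :
    Function.Injective (desired C T i) := by
  rw [injective_iff_map_eq_zero]
  intro y hy
  have h := hC.eq_zero_of_sent (isHelperSet_helperSet hC.k_le_d hT i) (x := Pi.single i y) (by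
    rintro (m | m) hm
    · have hm : m ≠ i := by simpa [helperSet] using hm
      simp [sent, stored, Pi.single_eq_of_ne hm]
    · have hm : m ∈ T := by simpa [helperSet] using hm
      rw [sent, stored_single_inr]
      exact congrFun hy ⟨m, hm⟩)
  simpa using h

lemma desired_surjective (hC : C.IsMSR d) (hT : T.card = d - k + 1) (i : Fin k) :
    Function.Surjective (desired C T i) := by
  refine (LinearMap.injective_iff_surjective_of_finrank_eq_finrank ?_).1
    (hC.desired_injective hT i)
  rw [Module.finrank_pi_fintype F (M := fun _ : T => Fin β → F)]
  simp only [Module.finrank_fin_fun, Finset.sum_const, Finset.card_univ, Fintype.card_coe, hT,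
    smul_eq_mul]
  rw [mul_comm, hC.optimal_bandwidth]

lemma parity_repair_surjective (hC : C.IsMSR d) (hT : T.card = d - k + 1) (i : Fin k)
    {t : Fin (n - k)} (ht : t ∈ T) :
    Function.Surjective (C.V i (helperSet T i) (Sum.inr t)).mulVecLin := by
  intro z
  obtain ⟨y, hy⟩ := hC.desired_surjective hT i fun _ => z
  exact ⟨C.A t i *ᵥ y, congrFun hy ⟨t, ht⟩⟩

/-- Interference alignment, in terms of the kernels of the repair matrices. -/
lemma interference_aligned (hC : C.IsMSR d) (hT : T.card = d - k + 1) {i j : Fin k}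
    (hij : j ≠ i) {y : Fin α → F} (hy : C.V i (helperSet T i) (Sum.inl j) *ᵥ y = 0)
    {t : Fin (n - k)} (ht : t ∈ T) :
    C.V i (helperSet T i) (Sum.inr t) *ᵥ (C.A t j *ᵥ y) = 0 := by
  -- Choose content `z` of the failed node that cancels the interference of `y` at every parity in
  -- `T`. No helper then sends anything nonzero, so repair forces `z = 0`, and the interference was
  -- itself zero.
  obtain ⟨z, hz⟩ := hC.desired_surjective hT i
    fun s => -(C.V i (helperSet T i) (Sum.inr s) *ᵥ (C.A s j *ᵥ y))
  have hz' (s) (hs : s ∈ T) : C.V i (helperSet T i) (Sum.inr s) *ᵥ (C.A s i *ᵥ z) =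
      -(C.V i (helperSet T i) (Sum.inr s) *ᵥ (C.A s j *ᵥ y)) := congrFun hz ⟨s, hs⟩
  have h := hC.eq_zero_of_sent (isHelperSet_helperSet hC.k_le_d hT i)
    (x := Pi.single i z + Pi.single j y) (by
      rintro (m | m) hm
      · have hm : m ≠ i := by simpa [helperSet] using hm
        by_cases hmj : m = j
        · subst hmj
          simpa [sent, stored, Pi.single_eq_of_ne hm] using hy
        · simp [sent, stored, Pi.single_eq_of_ne hm, Pi.single_eq_of_ne hmj]
      · have hm : m ∈ T := by simpa [helperSet] using hm
        rw [sent, stored_add, stored_single_inr, stored_single_inr, Matrix.mulVec_add,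
          hz' m hm, neg_add_cancel])
  have hz0 : z = 0 := by simpa [Pi.single_eq_of_ne hij.symm] using h
  simpa [hz0] using hz' t ht

/-- Alignment gives one inclusion. The parity's repair matrix has full rank `β` and that of helper
`j` has rank at most `β`, so a dimension count gives equality. -/
lemma map_ker_eq (hC : C.IsMSR d) (hT : T.card = d - k + 1) {i j : Fin k}
    (hij : j ≠ i) {t : Fin (n - k)} (ht : t ∈ T) :
    (LinearMap.ker (C.V i (helperSet T i) (Sum.inl j)).mulVecLin).map
        (hC.codingEquiv t j).toLinearMap =
      LinearMap.ker (C.V i (helperSet T i) (Sum.inr t)).mulVecLin := by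
  apply Submodule.eq_of_le_of_finrank_le
  · rintro _ ⟨y, hy, rfl⟩
    exact hC.interference_aligned hT hij hy ht
  · rw [LinearEquiv.finrank_map_eq]
    have h₁ := LinearMap.finrank_range_add_finrank_ker
      (C.V i (helperSet T i) (Sum.inl j)).mulVecLin
    have h₂ := LinearMap.finrank_range_add_finrank_ker
      (C.V i (helperSet T i) (Sum.inr t)).mulVecLin
    have h₃ := LinearMap.finrank_range_of_inj
      (f := (LinearMap.id : (Fin α → F) →ₗ[F] _)) Function.injective_id
    have h₄ := Submodule.finrank_le
      (LinearMap.range (C.V i (helperSet T i) (Sum.inl j)).mulVecLin)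
    rw [LinearMap.range_eq_top.2 (hC.parity_repair_surjective hT i ht), finrank_top] at h₂
    omega

end IsMSR

/-! ### Decay of the hidden spaces under several repairs. -/

/-- The vectors that are invisible in the symbols that node `m` sends for the repairs of the
nodes in `E`. -/
def invisible (C : LinearDSS F n k α β) (T : Finset (Fin (n - k))) (E : Finset (Fin k))
    (m : Node n k) : Submodule F (Fin α → F) :=
  E.inf fun i => LinearMap.ker (C.V i (helperSet T i) m).mulVecLin

lemma mem_invisible {C : LinearDSS F n k α β} {T : Finset (Fin (n - k))} {E : Finset (Fin k)}
    {m : Node n k} {y : Fin α → F} :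
    y ∈ C.invisible T E m ↔ ∀ i ∈ E, C.V i (helperSet T i) m *ᵥ y = 0 := by
  simp [invisible, Submodule.mem_finsetInf]

namespace IsMSR

variable {C : LinearDSS F n k α β} {T : Finset (Fin (n - k))}

lemma map_invisible (hC : C.IsMSR d) (hT : T.card = d - k + 1) {E : Finset (Fin k)}
    {j : Fin k} (hj : j ∉ E) {t : Fin (n - k)} (ht : t ∈ T) :
    (C.invisible T E (Sum.inl j)).map (hC.codingEquiv t j).toLinearMap =
      C.invisible T E (Sum.inr t) := by
  ext y
  rw [Submodule.mem_map_equiv, mem_invisible, mem_invisible]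
  refine forall₂_congr fun i hi => ?_
  have h := hC.map_ker_eq hT (i := i) (j := j) (fun h => hj (h ▸ hi)) ht
  have := Submodule.ext_iff.1 h y
  rwa [Submodule.mem_map_equiv] at this

lemma finrank_invisible (hC : C.IsMSR d) (hT : T.card = d - k + 1) {E : Finset (Fin k)}
    {j : Fin k} (hj : j ∉ E) {t : Fin (n - k)} (ht : t ∈ T) :
    Module.finrank F (C.invisible T E (Sum.inr t)) =
      Module.finrank F (C.invisible T E (Sum.inl j)) := by
  rw [← hC.map_invisible hT hj ht, LinearEquiv.finrank_map_eq]

lemma finrank_invisible_insert (hC : C.IsMSR d) (hT : T.card = d - k + 1)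
    {E : Finset (Fin k)} {i j : Fin k} (hi : i ∉ E) (hj : j ∉ insert i E) :
    Module.finrank F (C.invisible T E (Sum.inl j)) +
        (d - k + 1) * Module.finrank F (C.invisible T (insert i E) (Sum.inl j)) ≤
      (d - k + 1) * Module.finrank F (C.invisible T E (Sum.inl j)) := by
  have hjE : j ∉ E := fun h => hj (Finset.mem_insert_of_mem h)
  -- The symbols that `t` sends for `i`, restricted to what it has hidden from `E`; by rank-nullity
  -- the rank of this map is the drop in hidden dimension.
  let g (t : T) : C.invisible T E (Sum.inr t.1) →ₗ[F] (Fin β → F) :=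
    (C.V i (helperSet T i) (Sum.inr t.1)).mulVecLin ∘ₗ Submodule.subtype _
  have hg (t : T) : Module.finrank F (LinearMap.range (g t)) +
      Module.finrank F (C.invisible T (insert i E) (Sum.inl j)) =
      Module.finrank F (C.invisible T E (Sum.inl j)) := by
    rw [← hC.finrank_invisible hT hjE t.2, ← hC.finrank_invisible hT hj t.2,
      ← LinearMap.finrank_range_add_finrank_ker (g t)]
    have hker : C.invisible T E (Sum.inr t.1) ⊓
        LinearMap.ker (C.V i (helperSet T i) (Sum.inr t.1)).mulVecLin =
        C.invisible T (insert i E) (Sum.inr t.1) := by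
      ext y
      simp [mem_invisible, and_comm]
    rw [LinearMap.ker_comp, ← Submodule.finrank_map_subtype_eq, Submodule.map_comap_subtype,
      hker]
  -- This is `desired` on the hidden space of node `i`. Alignment for `E`, available because `i ∉
  -- E`, puts its components in the small ranges of the maps `g t`.
  let f : C.invisible T E (Sum.inl i) →ₗ[F] ((t : T) → LinearMap.range (g t)) :=
    LinearMap.pi fun t => (g t).rangeRestrict ∘ₗ
      ((hC.codingEquiv t.1 i).toLinearMap.restrict fun y hy => by
        rw [← hC.map_invisible hT hi t.2]
        exact Submodule.mem_map_of_mem hy)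
  have hf : Function.Injective f := by
    intro y z hyz
    apply Subtype.ext
    apply hC.desired_injective hT i
    funext t
    exact congrArg Subtype.val (congrFun hyz t)
  have hle := LinearMap.finrank_le_finrank_of_injective hf
  obtain ⟨t, ht⟩ : T.Nonempty := Finset.card_pos.1 (by omega)
  rw [Module.finrank_pi_fintype, ← hC.finrank_invisible hT hi ht,
    hC.finrank_invisible hT hjE ht] at hle
  have hsum := Finset.sum_congr (rfl : (Finset.univ : Finset T) = _) fun t _ => hg t
  rw [Finset.sum_add_distrib] at hsum
  simp only [Finset.sum_const, Finset.card_univ, Fintype.card_coe, hT, smul_eq_mul] at hsum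
  omega

lemma finrank_invisible_le (hC : C.IsMSR d) (hT : T.card = d - k + 1) {j : Fin k}
    {E : Finset (Fin k)} (hj : j ∉ E) :
    (Module.finrank F (C.invisible T E (Sum.inl j)) : ℝ) ≤
      (1 - 1 / ((d : ℝ) - k + 1)) ^ E.card * α := by
  induction E using Finset.induction_on with
  | empty =>
    have h := Submodule.finrank_le (C.invisible T ∅ (Sum.inl j))
    rw [Module.finrank_fin_fun] at h
    simpa using h
  | insert i E hi ih =>
    have h₁ := hC.finrank_invisible_insert hT hi hj
    have h₂ := ih fun h => hj (Finset.mem_insert_of_mem h)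
    have hr : ((d - k + 1 : ℕ) : ℝ) = (d : ℝ) - k + 1 := by
      rw [Nat.cast_add, Nat.cast_sub hC.k_le_d, Nat.cast_one]
    have hr1 : (1 : ℝ) ≤ ((d - k + 1 : ℕ) : ℝ) := by exact_mod_cast Nat.succ_pos (d - k)
    have h₁' := (Nat.cast_le (α := ℝ)).2 h₁
    rw [Nat.cast_add, Nat.cast_mul, Nat.cast_mul] at h₁'
    rw [← hr] at h₂ ⊢
    generalize ((d - k + 1 : ℕ) : ℝ) = r at *
    have hr0 : 0 < r := by linarith
    have hc : 0 ≤ 1 - 1 / r := by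
      rw [sub_nonneg, div_le_one hr0]
      exact hr1
    calc (Module.finrank F (C.invisible T (insert i E) (Sum.inl j)) : ℝ)
        ≤ (1 - 1 / r) * Module.finrank F (C.invisible T E (Sum.inl j)) := by
          refine le_of_mul_le_mul_left ?_ hr0
          field_simp
          linarith
      _ ≤ (1 - 1 / r) * ((1 - 1 / r) ^ E.card * α) := mul_le_mul_of_nonneg_left h₂ hc
      _ = _ := by rw [Finset.card_insert_of_notMem hi, pow_succ]; ring

/-- There are few contents of the systematic nodes that agree with given observations. -/
lemma card_le_of_observations_eq [Fintype F] (hC : C.IsMSR d) (hT : T.card = d - k + 1)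
    {Es : Finset (Node n k)} {Ed G : Finset (Fin k)}
    (hcard : Es.card + Ed.card + G.card = k) (hEd : ∀ j ∈ Ed, (Sum.inl j : Node n k) ∉ Es)
    (hG : ∀ j ∈ G, (Sum.inl j : Node n k) ∉ Es) (hEdG : Disjoint Ed G)
    (s : Finset (Fin k → Fin α → F))
    (hs : ∀ x ∈ s, ∀ x' ∈ s, C.storedOn Es x = C.storedOn Es x' ∧
      C.downloadedBy Ed (helperSet T) x = C.downloadedBy Ed (helperSet T) x') :
    s.card ≤ Fintype.card F ^
      ∑ j ∈ G, Module.finrank F (C.invisible T Ed (Sum.inl j)) := by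
  classical
  obtain rfl | ⟨x₀, hx₀⟩ := s.eq_empty_or_nonempty
  · simp
  have hsent (x) (hx : x ∈ s) (x') (hx' : x' ∈ s) (i) (hi : i ∈ Ed) (m)
      (hm : m ∈ helperSet T i) : C.sent (x - x') i (helperSet T i) m = 0 := by
    rw [sent_sub, sub_eq_zero]
    exact congrFun (congrFun (hs x hx x' hx').2 ⟨i, hi⟩) ⟨m, hm⟩
  -- Subtracting a base point `x₀` with the same observations moves the content of node `j` into its
  -- hidden space.
  let f (x : s) (j : G) : C.invisible T Ed (Sum.inl j.1) :=
    ⟨(x.1 - x₀) j.1, mem_invisible.2 fun i hi => by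
      refine hsent x x.2 x₀ hx₀ i hi (Sum.inl j.1) ?_
      have : j.1 ≠ i := fun h => Finset.disjoint_left.1 hEdG hi (h ▸ j.2)
      simpa [helperSet] using this⟩
  have hf : Function.Injective f := by
    intro x x' hxx'
    apply Subtype.ext
    rw [← sub_eq_zero]
    have hinl : Disjoint Es ((Ed ∪ G).map Function.Embedding.inl) := by
      rw [Finset.disjoint_right]
      intro m hm
      obtain ⟨j, hj, rfl⟩ := Finset.mem_map.1 hm
      exact (Finset.mem_union.1 hj).elim (hEd j) (hG j)
    -- The nodes in `Es`, `Ed` and `G` number exactly `k`. The difference vanishes on `Es` by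
    -- observation, on `Ed` by repair, and on `G` because `f` agrees.
    refine hC.eq_zero_of_stored (S := Es ∪ (Ed ∪ G).map Function.Embedding.inl) ?_ ?_
    · rw [Finset.card_union_of_disjoint hinl, Finset.card_map,
        Finset.card_union_of_disjoint hEdG]
      omega
    · intro m hm
      obtain hm | hm := Finset.mem_union.1 hm
      · rw [stored_sub, sub_eq_zero]
        exact congrFun (hs x x.2 x' x'.2).1 ⟨m, hm⟩
      · obtain ⟨j, hj, rfl⟩ := Finset.mem_map.1 hm
        obtain hj | hj := Finset.mem_union.1 hj
        · exact hC.eq_zero_of_sent (isHelperSet_helperSet hC.k_le_d hT j)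
            (hsent x x.2 x' x'.2 j hj)
        · have h := congrArg Subtype.val (congrFun hxx' ⟨j, hj⟩)
          simpa [f, stored, sub_eq_zero] using h
  have h := Nat.card_le_card_of_injective f hf
  rw [Nat.card_pi, Finset.prod_congr rfl fun j _ => Module.natCard_eq_pow_finrank (K := F),
    Finset.prod_pow_eq_pow_sum, Nat.card_eq_fintype_card (α := F)] at h
  rwa [Nat.card_eq_fintype_card, Fintype.card_coe,
    Finset.sum_coe_sort G fun j => Module.finrank F (C.invisible T Ed (Sum.inl j))] at h

end IsMSR

end LinearDSS

/-! ### Entropy bounds from the size of the support. -/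

section Entropy

/-- Jensen's inequality for the concave `Real.negMulLog`, with uniform weights on `s`. -/
lemma sum_negMulLog_le_log_card {A : Type*} [Fintype A] {p : A → ℝ} (hp : ∀ a, 0 ≤ p a)
    (hsum : ∑ a, p a = 1) {s : Finset A} (hs : ∀ a ∉ s, p a = 0) :
    ∑ a, Real.negMulLog (p a) ≤ Real.log s.card := by
  have hsum' : ∑ a ∈ s, p a = 1 := by
    rw [← hsum]
    exact Finset.sum_subset (Finset.subset_univ s) fun a _ ha => hs a ha
  have hne : s.Nonempty := by
    rw [Finset.nonempty_iff_ne_empty]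
    rintro rfl
    simp at hsum'
  have hc : (0 : ℝ) < s.card := by exact_mod_cast hne.card_pos
  have hJ := Real.concaveOn_negMulLog.le_map_sum (t := s) (w := fun _ => (s.card : ℝ)⁻¹) (p := p)
    (fun _ _ => by positivity) (by simp [hc.ne']) fun a _ => hp a
  simp only [smul_eq_mul, ← Finset.mul_sum, hsum'] at hJ
  rw [mul_one, Real.negMulLog, Real.log_inv, neg_mul_neg] at hJ
  rw [← Finset.sum_subset (Finset.subset_univ s) fun a _ ha => by simp [hs a ha]]
  exact le_of_mul_le_mul_left hJ (inv_pos.2 hc)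

variable {Ω A B : Type*} [Fintype A] [Fintype B] (P : PMF Ω) (X : Ω → A) (Y : Ω → B)

lemma sum_toReal_map_prodMk (y : B) :
    ∑ a, (P.map (fun ω => (X ω, Y ω)) (a, y)).toReal = (P.map Y y).toReal := by
  classical
  rw [← ENNReal.toReal_sum fun a _ => PMF.apply_ne_top _ _]
  congr 1
  have : P.map Y = (P.map fun ω => (X ω, Y ω)).map Prod.snd := by
    rw [PMF.map_comp]
    rfl
  rw [this, PMF.map_apply, tsum_fintype, Fintype.sum_prod_type]
  simp

lemma sum_conditional_eq_one {y : B} (hy : (P.map Y y).toReal ≠ 0) :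
    ∑ a, (P.map (fun ω => (X ω, Y ω)) (a, y)).toReal / (P.map Y y).toReal = 1 := by
  rw [← Finset.sum_div, sum_toReal_map_prodMk, div_self hy]

lemma sum_toReal_eq_one (p : PMF A) : ∑ a, (p a).toReal = 1 := by
  have h := p.tsum_coe
  rw [tsum_fintype] at h
  rw [← ENNReal.toReal_sum fun a _ => PMF.apply_ne_top _ _, h, ENNReal.toReal_one]

lemma condEntropy_le_of_card_support_le {b : ℕ} (hb : 1 < b) {N : ℕ}
    (h : ∀ y, ∀ s : Finset A, (∀ a ∈ s, ∃ ω ∈ P.support, X ω = a ∧ Y ω = y) → s.card ≤ N) :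
    condEntropy b P X Y ≤ Real.log N / Real.log b := by
  classical
  have hb' : 0 < Real.log b := Real.log_pos (by exact_mod_cast hb)
  refine div_le_div_of_nonneg_right ?_ hb'.le
  calc _ ≤ ∑ y, (P.map Y y).toReal * Real.log N := Finset.sum_le_sum fun y _ => ?_
    _ = Real.log N := by rw [← Finset.sum_mul, sum_toReal_eq_one, one_mul]
  by_cases hy : (P.map Y y).toReal = 0
  · rw [hy, zero_mul, zero_mul]
  refine mul_le_mul_of_nonneg_left ?_ ENNReal.toReal_nonneg
  let s : Finset A := {a | (P.map (fun ω => (X ω, Y ω)) (a, y)).toReal ≠ 0}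
  have hs1 : 0 < s.card := by
    by_contra hs
    have hs : s = ∅ := by simpa using hs
    apply hy
    rw [← sum_toReal_map_prodMk P X Y]
    refine Finset.sum_eq_zero fun a _ => ?_
    by_contra ha
    have : a ∈ s := Finset.mem_filter.2 ⟨Finset.mem_univ a, ha⟩
    simp [hs] at this
  have hsN : s.card ≤ N := h y s fun a ha => by
    have ha := (Finset.mem_filter.1 ha).2
    have : (a, y) ∈ (P.map fun ω => (X ω, Y ω)).support := fun h0 => ha (by rw [h0]; rfl)
    obtain ⟨ω, hω, hωa⟩ := (PMF.mem_support_map_iff _ _ _).1 this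
    exact ⟨ω, hω, congrArg Prod.fst hωa, congrArg Prod.snd hωa⟩
  refine (sum_negMulLog_le_log_card (fun a => by positivity)
    (sum_conditional_eq_one P X Y hy) (s := s) fun a ha => ?_).trans
    (Real.log_le_log (by exact_mod_cast hs1) (by exact_mod_cast hsN))
  have : (P.map (fun ω => (X ω, Y ω)) (a, y)).toReal = 0 := by
    by_contra h0
    exact ha (Finset.mem_filter.2 ⟨Finset.mem_univ a, h0⟩)
  rw [this, zero_div]

variable {P X Y}

lemma toReal_map_apply_ne_zero {C : Type*} (f : Ω → C) {ω : Ω} (hω : ω ∈ P.support) :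
    (P.map f (f ω)).toReal ≠ 0 :=
  ENNReal.toReal_ne_zero.2 ⟨(PMF.mem_support_map_iff _ _ _).2 ⟨ω, hω, rfl⟩,
    PMF.apply_ne_top _ _⟩

/-- All terms of the sum are nonnegative, so each vanishes and every conditional probability is `0`
or `1`. Two distinct values compatible with the same `y` would have total probability `2`. -/
lemma eq_of_condEntropy_eq_zero {b : ℕ} (hb : 1 < b) (h : condEntropy b P X Y = 0)
    {ω ω' : Ω} (hω : ω ∈ P.support) (hω' : ω' ∈ P.support) (hY : Y ω = Y ω') :
    X ω = X ω' := by
  classical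
  have hb' : 0 < Real.log b := Real.log_pos (by exact_mod_cast hb)
  set y := Y ω with hy
  let q : A → ℝ := fun a =>
    (P.map (fun ω => (X ω, Y ω)) (a, y)).toReal / (P.map Y y).toReal
  have hle (a : A) (y : B) : (P.map (fun ω => (X ω, Y ω)) (a, y)).toReal ≤
      (P.map Y y).toReal := by
    rw [← sum_toReal_map_prodMk P X Y]
    exact Finset.single_le_sum
      (f := fun a => (P.map (fun ω => (X ω, Y ω)) (a, y)).toReal)
      (fun _ _ => ENNReal.toReal_nonneg) (Finset.mem_univ a)
  have hterm (a : A) (y : B) : 0 ≤ Real.negMulLog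
      ((P.map (fun ω => (X ω, Y ω)) (a, y)).toReal / (P.map Y y).toReal) :=
    Real.negMulLog_nonneg (by positivity) (div_le_one_of_le₀ (hle a y) ENNReal.toReal_nonneg)
  have hsum := (div_eq_zero_iff.1 h).resolve_right hb'.ne'
  rw [Finset.sum_eq_zero_iff_of_nonneg fun y _ =>
    mul_nonneg ENNReal.toReal_nonneg (Finset.sum_nonneg fun a _ => hterm a y)] at hsum
  have hyp : (P.map Y y).toReal ≠ 0 := toReal_map_apply_ne_zero Y hω
  have hq := (mul_eq_zero.1 (hsum y (Finset.mem_univ y))).resolve_left hyp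
  rw [Finset.sum_eq_zero_iff_of_nonneg fun a _ => hterm a y] at hq
  have hone (ω) (hω : ω ∈ P.support) (hYω : Y ω = y) : q (X ω) = 1 := by
    have h0 : 0 ≤ q (X ω) := by positivity
    have hne : q (X ω) ≠ 0 := by
      refine div_ne_zero ?_ hyp
      have := toReal_map_apply_ne_zero (fun ω => (X ω, Y ω)) hω
      rwa [hYω] at this
    have := hq (X ω) (Finset.mem_univ _)
    rw [Real.negMulLog, neg_mul, neg_eq_zero] at this
    exact Real.eq_one_of_pos_of_log_eq_zero (lt_of_le_of_ne h0 hne.symm)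
      ((mul_eq_zero.1 this).resolve_left hne)
  by_contra hX
  have h2 : ∑ a ∈ {X ω, X ω'}, q a ≤ 1 := by
    rw [← sum_conditional_eq_one P X Y hyp]
    exact Finset.sum_le_sum_of_subset_of_nonneg (Finset.subset_univ _) fun a _ _ => by positivity
  rw [Finset.sum_pair hX, hone ω hω rfl, hone ω' hω' hY.symm] at h2
  norm_num at h2

lemma entropy_of_uniform {b M : ℕ} (hb : 1 < b) [Nonempty A]
    (hA : Fintype.card A = b ^ M) (h : P.map X = PMF.uniformOfFintype A) :
    entropy b P X = M := by
  have hb' : 0 < Real.log b := Real.log_pos (by exact_mod_cast hb)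
  have hbM : ((b : ℝ) ^ M) ≠ 0 := pow_ne_zero _ (by positivity)
  simp only [entropy, h, PMF.uniformOfFintype_apply, Finset.sum_const, Finset.card_univ, hA,
    Real.negMulLog, nsmul_eq_mul, ENNReal.toReal_inv, ENNReal.toReal_pow, ENNReal.toReal_natCast, Nat.cast_pow,
    Real.log_inv, Real.log_pow]
  field_simp

end Entropy

end

/-! ### The secrecy bound. -/

theorem theorem1 {F : Type*} [Field F] [Fintype F] {n k d α β : ℕ}
    (C : LinearDSS F n k α β) (hC : C.IsMSR d)
    {ℓ₁ ℓ₂ : ℕ} (hℓ : ℓ₁ + ℓ₂ < k)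
    (Es : Finset (Node n k)) (Ed : Finset (Fin k))
    (hEs : Es.card = ℓ₁) (hEd : Ed.card = ℓ₂)
    (hdisj : ∀ j ∈ Ed, (Sum.inl j : Node n k) ∉ Es)
    {Ω : Type*} (P : PMF Ω) {M : ℕ} (U : Ω → Fin M → F) (X : Ω → Fin k → Fin α → F)
    (hU : P.map U = PMF.uniformOfFintype (Fin M → F))
    (hrec : C.IsReconstructible P U X)
    (hsec : C.IsPerfectlySecret d P U X Es Ed) :
    (M : ℝ) ≤ ((k : ℝ) - ℓ₁ - ℓ₂) * (1 - 1 / ((d : ℝ) - k + 1)) ^ ℓ₂ * α := by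
  classical
  have hkd := hC.k_le_d
  have hdn := hC.d_lt_n
  have hq : 1 < Fintype.card F := Fintype.one_lt_card
  have hlog : 0 < Real.log (Fintype.card F) := Real.log_pos (by exact_mod_cast hq)
  obtain ⟨T, -, hT⟩ := Finset.exists_subset_card_eq
    (s := (Finset.univ : Finset (Fin (n - k)))) (n := d - k + 1)
    (by rw [Finset.card_univ, Fintype.card_fin]; omega)
  obtain ⟨G, hGsub, hG⟩ := Finset.exists_subset_card_eq
    (s := (Es.toLeft ∪ Ed)ᶜ) (n := k - ℓ₁ - ℓ₂) (by
      have h₁ := Finset.card_union_le Es.toLeft Ed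
      have h₂ := Es.card_toLeft_le
      rw [Finset.card_compl, Fintype.card_fin]
      omega)
  have hGE (j) (hj : j ∈ G) : (Sum.inl j : Node n k) ∉ Es ∧ j ∉ Ed := by
    simpa using hGsub hj
  have hdet {ω ω'} (hω : ω ∈ P.support) (hω' : ω' ∈ P.support) (h : X ω = X ω') :
      U ω = U ω' :=
    eq_of_condEntropy_eq_zero hq
      (hrec (Finset.univ.map Function.Embedding.inl) (by simp)) hω hω' (by rw [h])
  have : Nonempty Ω := ⟨P.support_nonempty.some⟩
  have hent := hsec (LinearDSS.helperSet T)
    fun j _ => LinearDSS.isHelperSet_helperSet hkd hT j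
  rw [entropy_of_uniform hq (M := M) (by simp) hU] at hent
  have hle := condEntropy_le_of_card_support_le P U
    (fun ω => (C.storedOn Es (X ω), C.downloadedBy Ed (LinearDSS.helperSet T) (X ω))) hq
    (N := Fintype.card F ^
      ∑ j ∈ G, Module.finrank F (C.invisible T Ed (Sum.inl j))) (by
    intro z s hs
    -- Pick an outcome for each compatible file. As the systematic data determine the file, distinct
    -- files give distinct data vectors with the same view, so it suffices to count the latter.
    choose! w hw hwU hwZ using hs
    have hinj : Set.InjOn (fun u => X (w u)) s := fun u hu u' hu' h => by
      rw [← hwU u hu, ← hwU u' hu']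
      exact hdet (hw u hu) (hw u' hu') h
    rw [← Finset.card_image_of_injOn hinj]
    refine hC.card_le_of_observations_eq hT (by omega) hdisj (fun j hj => (hGE j hj).1)
      (Finset.disjoint_right.2 fun j hj => (hGE j hj).2) _ ?_
    simp only [Finset.mem_image]
    rintro _ ⟨u, hu, rfl⟩ _ ⟨u', hu', rfl⟩
    exact Prod.ext_iff.1 ((hwZ u hu).trans (hwZ u' hu').symm))
  rw [hent, Nat.cast_pow, Real.log_pow, mul_div_cancel_right₀ _ hlog.ne', Nat.cast_sum] at hle
  refine hle.trans ((Finset.sum_le_sum fun j hj =>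
    hC.finrank_invisible_le hT (hGE j hj).2).trans_eq ?_)
  rw [Finset.sum_const, hG, hEd, nsmul_eq_mul, Nat.cast_sub (by omega), Nat.cast_sub (by omega),
    mul_assoc]
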